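/- **Setting.** There are $N_A$ robots in a workspace $\mathcal W\subset\mathbb R^w$, $w\in\{2,3\}$, with finitely many static obstacles. Robot $i$ has dynamics $x_{k+1}=A^ix_k+B^iu_k+w_k$, $w_k\sim\mathcal N(0,Q^i)$, measurements $y_k=C^ix_k+v_k$, $v_k\sim\mathcal N(0,R^i)$ ($R^i$ positive definite), a Kalman filter, a feedback $u_k=\check u_k-K^i(\hat x_k-\check x_k)$, a state set $\mathcal X^i$, a control set $\mathcal U^i$, a rigid body placed in $\mathcal W$ according to the state, an initial belief $\mathcal N(\hat x^i_0,\Sigma^i_0)$ and a goal region $\mathcal X^i_G\subseteq\mathcal X^i$. A motion plan of robot $i$ consists of nominal controls $\check u^i_0,\dots,\check u^i_{T^i-1}\in\mathcal U^i$ ($T^i\ge1$) and the nominal states $\check x^i_k\in\mathcal X^i$ that they generate from $\check x^i_0=\hat x^i_0$ without noise. Its expected belief at time $k\le T^i$ is $b^i_k=\mathcal N(\check x^i_k,\Gamma^i_k)$ with $\Gamma_k=\Sigma_k+\Lambda_k$, $\Lambda_0=0$, $\Sigma_k^-=A\Sigma_{k-1}A^{T}+Q$, $L_k=\Sigma_k^-C^T(C\Sigma_k^-C^T+R)^{-1}$,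 $\Sigma_k=\Sigma^-_k-L_kC\Sigma^-_k$, $\Lambda_k=(A-BK)\Lambda_{k-1}(A-BK)^T+L_kC\Sigma_k^-$ (indices $i$ omitted); a robot that has finished keeps its last belief. Plan lengths lie in a given set $H\subseteq\mathbb N$ ($H=\{T\}$ imposes the common length $T$). Let $P_O^{i}(b)$ be the probability under a belief $b$ of robot $i$ that its state lies in $\mathcal X^i$ and is in collision with a static obstacle or violates the given velocity limits, let $P^{ij}_{coll}(b,b')$ be the probability under independent beliefs $b,b'$ that the states of robots $i$ and $j$ lie in $\mathcal X^i\times\mathcal X^j$ and their bodies intersect, and let $P^i_G$ be the probability under $b^i_{T^i}$ that robot $i$ is in its goal region. Given $p_{safe}\in[0,1]$, a *solution* is a family of motion plans, one per robot, with $$P^i_O(b^i_k)+\sum_{j\ne i}P^{ij}_{coll}(b^i_k,b^j_k)\le 1-p_{safe}\quad(1\le k\le\max_jT^j),\qquad P^i_G\ge p_{safe}\qquad\text{for all } i.$$ An *over-approximation* $\rho$ consists of real functions $\rho^i_O\ge P^i_O$ and $\rho^{ij}\ge P^{ij}_{coll}$ ($i\neq j$) of Gaussian beliefs ($\rho^i_O=P^i_O$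 is allowed). A *$\rho$-solution* is defined like a solution, with $\rho$ in place of the collision probabilities. **Algorithm.** CC-K-CBS with parameters $N,B\ge1$ is the following high-level search over a constraint tree. The root has a plan for each robot, computed separately by the low-level planner, without constraints. In each pass it takes the node on top of the queue, by an arbitrary heuristic. * If the node's plan is empty (some low-level search has not succeeded), these searches are continued for $N$ iterations and the node is put back. * Otherwise *validatePlan*, evaluating the constraints with $\rho$, either accepts (exactly if the plan is a $\rho$-solution), and the plan is returned; or it reports a conflict $\langle i,j,[t_s,t_e]\rangle$, in which robot $i$ violates its constraint throughout $[t_s,t_e]$ and $\rho^{ij}>0$ there, with $i$ and $j$ in different (meta-)robots. Then the node is replaced by two children. In one, robot $i$ gets the belief-constraint to satisfy its chance constraint (evaluated with $\rho$) against the current belief of $j$ during $[t_s,t_e]$; in the other, dually for $j$. The constrained (meta-)robot is replanned by a new search for $N$ iterations. * When more than $B$ conflicts have arisen since the last (re)start, the (meta-)robots of the last conflict are merged into one meta-robot and the search restarts. A reported conflict counts as arising, and counts again each time the replanning of a child created from it is retried and still finds no plan. The low-level planner (Belief-$\mathcal A$) is randomized, plans for a robot or meta-robot under its chance constraints, evaluated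 with $\rho$, and the belief-constraints, and reports only plans that satisfy them; different searches draw independent samples. It is *probabilistically complete* if, for each such task that has a valid plan, a search almost surely finds one after finitely many iterations. **Corollary (following Theorem 1).** Suppose that *validatePlan* uses an over-approximation $\rho$ of the collision probabilities, and that the low-level planner is probabilistically complete. Then CC-K-CBS is probabilistically complete relative to $\rho$: if a $\rho$-solution exists, then CC-K-CBS almost surely returns a plan after finitely many passes. Moreover CC-K-CBS is sound: every plan that it returns, in any run, is a $\rho$-solution and also a solution for the exact collision probabilities. -/

import Mathlib

open MeasureTheory ProbabilityTheory
open scoped Matrix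

namespace CCKCBS

/-- Euclidean space of dimension `d`. -/
abbrev E (d : ℕ) : Type := EuclideanSpace ℝ (Fin d)

/-! ### Robots, beliefs and motion plans -/

/-- One robot in a workspace of dimension `w`: dynamics `x' = A x + B u + N(0, Q)`, sensor
`y = C x + N(0, R)`, feedback gain `K`, rigid body, initial belief `N(x0, S0)` and goal region. -/
structure Robot (w : ℕ) where
  n : ℕ
  p : ℕ
  m : ℕ
  A : Matrix (Fin n) (Fin n) ℝ
  B : Matrix (Fin n) (Fin p) ℝ
  C : Matrix (Fin m) (Fin n) ℝ
  Q : Matrix (Fin n) (Fin n) ℝ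
  R : Matrix (Fin m) (Fin m) ℝ
  K : Matrix (Fin p) (Fin n) ℝ
  /-- state space -/
  X : Set (E n)
  /-- control space -/
  U : Set (E p)
  /-- the body, in the local frame -/
  body : Set (E w)
  /-- the rigid motion that places the local frame in the workspace, read off from the state -/
  pose : E n → (E w ≃ᵃⁱ[ℝ] E w)
  /-- states that respect the limits on the velocity terms -/
  limits : Set (E n)
  x0 : E n
  S0 : Matrix (Fin n) (Fin n) ℝ
  goal : Set (E n)
  Q_psd : Q.PosSemidef
  R_pd : R.PosDef
  S0_psd : S0.PosSemidef
  x0_mem : x0 ∈ X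
  goal_subset : goal ⊆ X

/-- The set of workspace points that the robot occupies in state `x`. -/
def Robot.occupied {w : ℕ} (r : Robot w) (x : E r.n) : Set (E w) := r.pose x '' r.body

/-- A Gaussian belief `N(mean, cov)`. -/
structure Belief (n : ℕ) where
  mean : E n
  cov : Matrix (Fin n) (Fin n) ℝ

/-- The Gaussian law of a belief. -/
noncomputable def Belief.law {n : ℕ} (b : Belief n) : Measure (E n) :=
  multivariateGaussian b.mean b.cov

/-- Kalman gain for the predicted covariance `M`. -/
noncomputable def Robot.gain {w : ℕ} (r : Robot w) (M : Matrix (Fin r.n) (Fin r.n) ℝ) :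
    Matrix (Fin r.n) (Fin r.m) ℝ :=
  M * r.Cᵀ * (r.C * M * r.Cᵀ + r.R)⁻¹

/-- The pair `(Σ_k, Λ_k)`: covariance of the Kalman filter, and covariance of the state estimate
around the nominal state, before any measurement is known. -/
noncomputable def Robot.covs {w : ℕ} (r : Robot w) :
    ℕ → Matrix (Fin r.n) (Fin r.n) ℝ × Matrix (Fin r.n) (Fin r.n) ℝ
  | 0 => (r.S0, 0)
  | k + 1 =>
    let M := r.A * (r.covs k).1 * r.Aᵀ + r.Q
    let L := r.gain M
    (M - L * r.C * M,
      (r.A - r.B * r.K) * (r.covs k).2 * (r.A - r.B * r.K)ᵀ + L * r.C * M)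

/-- The covariance `Γ_k = Σ_k + Λ_k` of the expected belief. -/
noncomputable def Robot.gamma {w : ℕ} (r : Robot w) (k : ℕ) : Matrix (Fin r.n) (Fin r.n) ℝ :=
  (r.covs k).1 + (r.covs k).2

/-- The nominal states under the nominal controls `u 0, …, u (T - 1)`, without noise. After the
last control the robot rests. -/
noncomputable def Robot.nominal {w : ℕ} (r : Robot w) (T : ℕ) (u : Fin T → E r.p) : ℕ → E r.n
  | 0 => r.x0
  | k + 1 =>
    if h : k < T then
      WithLp.toLp 2 (r.A *ᵥ (r.nominal T u k).ofLp + r.B *ᵥ (u ⟨k, h⟩).ofLp)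
    else r.nominal T u k

/-- A motion plan of one robot, with `T ≥ 1` steps and `T` in the set `H` of admissible lengths. -/
structure MotionPlan {w : ℕ} (r : Robot w) (H : Set ℕ) where
  T : ℕ
  T_pos : 0 < T
  T_mem : T ∈ H
  u : Fin T → E r.p
  u_mem : ∀ k, u k ∈ r.U
  x_mem : ∀ k ≤ T, r.nominal T u k ∈ r.X

/-- The expected belief at time `k` under a motion plan (from time `T` on it stays the same). -/
noncomputable def MotionPlan.belief {w : ℕ} {r : Robot w} {H : Set ℕ} (π : MotionPlan r H)
    (k : ℕ) : Belief r.n :=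
  ⟨r.nominal π.T π.u k, r.gamma (min k π.T)⟩

/-! ### The chance-constrained problem -/

/-- An instance of the multi-robot problem with `NA` robots. -/
structure Problem (w NA : ℕ) where
  workspace : Set (E w)
  /-- number of static obstacles -/
  NO : ℕ
  obstacle : Fin NO → Set (E w)
  robot : Fin NA → Robot w
  /-- admissible plan lengths: `{T}` forces the common length `T`, `Set.univ` forces nothing -/
  lengths : Set ℕ
  psafe : ℝ
  psafe_mem : psafe ∈ Set.Icc (0 : ℝ) 1
  obstacle_subset : ∀ o, obstacle o ⊆ workspace
  occupied_subset : ∀ i, ∀ x ∈ (robot i).X, (robot i).occupied x ⊆ workspace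

variable {w NA : ℕ}

/-- The static obstacles in the state space of robot `i`. -/
def Problem.obstacleStates (P : Problem w NA) (i : Fin NA) : Set (E (P.robot i).n) :=
  {x | x ∈ (P.robot i).X ∧
    (x ∉ (P.robot i).limits ∨ ((P.robot i).occupied x ∩ ⋃ o, P.obstacle o).Nonempty)}

/-- The pairs of states in which the robots `i` and `j` collide. -/
def Problem.collisionStates (P : Problem w NA) (i j : Fin NA) :
    Set (E (P.robot i).n × E (P.robot j).n) :=
  {x | x.1 ∈ (P.robot i).X ∧ x.2 ∈ (P.robot j).X ∧
    ((P.robot i).occupied x.1 ∩ (P.robot j).occupied x.2).Nonempty}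

/-- Values that are used for the two kinds of collision probability, as functions of the beliefs. -/
structure CollisionRisk (P : Problem w NA) where
  /-- probability of a collision of robot `i` with the static obstacles -/
  obs : (i : Fin NA) → Belief (P.robot i).n → ℝ
  /-- probability of a collision between the robots `i` and `j` -/
  coll : (i j : Fin NA) → Belief (P.robot i).n → Belief (P.robot j).n → ℝ

/-- The exact collision probabilities. -/
noncomputable def Problem.exactRisk (P : Problem w NA) : CollisionRisk P where
  obs i b := b.law.real (P.obstacleStates i)
  coll i j b b' := (b.law.prod b'.law).real (P.collisionStates i j)

/-- `ρ` over-approximates the collision probabilities, for all Gaussian beliefs. -/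
def CollisionRisk.IsOverApprox {P : Problem w NA} (ρ : CollisionRisk P) : Prop :=
  (∀ i, ∀ b : Belief (P.robot i).n, b.cov.PosSemidef → P.exactRisk.obs i b ≤ ρ.obs i b) ∧
  (∀ i j, i ≠ j → ∀ (b : Belief (P.robot i).n) (b' : Belief (P.robot j).n),
    b.cov.PosSemidef → b'.cov.PosSemidef → P.exactRisk.coll i j b b' ≤ ρ.coll i j b b')

/-- Plans for all robots. -/
abbrev JointPlan (P : Problem w NA) : Type :=
  (i : Fin NA) → MotionPlan (P.robot i) P.lengths

/-- Plans for the robots of a group (a robot or a meta-robot). -/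
abbrev GroupPlan (P : Problem w NA) (G : Finset (Fin NA)) : Type :=
  (i : G) → MotionPlan (P.robot i) P.lengths

/-- The probability that a robot ends in its goal region. -/
noncomputable def goalProb {r : Robot w} {H : Set ℕ} (π : MotionPlan r H) : ℝ :=
  (π.belief π.T).law.real r.goal

/-- The length of a joint plan. -/
def JointPlan.horizon {P : Problem w NA} (π : JointPlan P) : ℕ :=
  Finset.univ.sup fun i => (π i).T

/-- The total collision risk of robot `i` at time `k` in a joint plan. -/
noncomputable def JointPlan.risk {P : Problem w NA} (ρ : CollisionRisk P) (π : JointPlan P)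
    (i : Fin NA) (k : ℕ) : ℝ :=
  ρ.obs i ((π i).belief k) +
    ∑ j ∈ Finset.univ.erase i, ρ.coll i j ((π i).belief k) ((π j).belief k)

/-- The joint plan solves the problem whose chance constraints are evaluated with `ρ`. -/
def JointPlan.Solves {P : Problem w NA} (ρ : CollisionRisk P) (π : JointPlan P) : Prop :=
  (∀ i, ∀ k ∈ Finset.Icc 1 π.horizon, π.risk ρ i k ≤ 1 - P.psafe) ∧
  (∀ i, P.psafe ≤ goalProb (π i))

/-! ### The low-level planner -/

/-- The length of the plan of a group. -/
def GroupPlan.horizon {P : Problem w NA} {G : Finset (Fin NA)} (π : GroupPlan P G) : ℕ :=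
  Finset.univ.sup fun i => (π i).T

/-- The collision risk of robot `i` of the group at time `k`, from the static obstacles and from
the other robots of the group. -/
noncomputable def GroupPlan.risk {P : Problem w NA} {G : Finset (Fin NA)} (ρ : CollisionRisk P)
    (π : GroupPlan P G) (i : G) (k : ℕ) : ℝ :=
  ρ.obs i ((π i).belief k) +
    ∑ j ∈ Finset.univ.erase i, ρ.coll i j ((π i).belief k) ((π j).belief k)

/-- A belief-constraint: during `[ts, te]`, robot `i` has to satisfy the chance constraint with the
given belief of robot `j`. -/
structure BeliefConstraint (P : Problem w NA) where
  i : Fin NA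
  j : Fin NA
  belief : ℕ → Belief (P.robot j).n
  ts : ℕ
  te : ℕ

/-- The plan of a group meets a belief-constraint. -/
def BeliefConstraint.Sat {P : Problem w NA} (ρ : CollisionRisk P) (c : BeliefConstraint P)
    {G : Finset (Fin NA)} (π : GroupPlan P G) : Prop :=
  ∀ hi : c.i ∈ G, ∀ k ∈ Finset.Icc c.ts c.te,
    π.risk ρ ⟨c.i, hi⟩ k + ρ.coll c.i c.j ((π ⟨c.i, hi⟩).belief k) (c.belief k) ≤ 1 - P.psafe

/-- A task of the low-level planner: plan for a group, under belief-constraints. -/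
structure Query (P : Problem w NA) where
  group : Finset (Fin NA)
  cstr : List (BeliefConstraint P)

/-- The valid plans of a low-level task. -/
def Query.Sat {P : Problem w NA} (ρ : CollisionRisk P) (q : Query P)
    (π : GroupPlan P q.group) : Prop :=
  (∀ i, ∀ k ∈ Finset.Icc 1 π.horizon, π.risk ρ i k ≤ 1 - P.psafe) ∧
  (∀ i, P.psafe ≤ goalProb (π i)) ∧
  (∀ c ∈ q.cstr, c.Sat ρ π)

/-- A low-level planner (the belief-space version of a sampling-based planner). `S` is the space of
the random samples that one search draws, and `run q s n` is the plan that a search for the task `q`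
with the samples `s` has found within `n` iterations, if any. It stops when it has found a plan, and
every plan that it reports is valid for the task. -/
structure Planner (P : Problem w NA) (ρ : CollisionRisk P) (S : Type*) where
  run : (q : Query P) → S → ℕ → Option (GroupPlan P q.group)
  run_mono : ∀ q s n m π, n ≤ m → run q s n = some π → run q s m = some π
  run_valid : ∀ q s n π, run q s n = some π → q.Sat ρ π

/-- The planner finds a valid plan almost surely, for every task that has one. -/
def Planner.ProbComplete {P : Problem w NA} {ρ : CollisionRisk P} {S : Type*}
    [MeasurableSpace S] (A : Planner P ρ S) (μ : Measure S) : Prop :=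
  ∀ q : Query P, (∃ π, q.Sat ρ π) → ∀ᵐ s ∂μ, ∃ n, (A.run q s n).isSome

/-! ### The high-level search -/

/-- The (meta-)robot that contains robot `i`, when `part` labels the robots and merged robots share
a label. -/
def grp (part : Fin NA → Fin NA) (i : Fin NA) : Finset (Fin NA) :=
  Finset.univ.filter fun l => part l = part i

theorem mem_grp (part : Fin NA → Fin NA) (i : Fin NA) : i ∈ grp part i := by
  simp [grp]

/-- Merge the (meta-)robots of `i` and `j`. -/
def mergeRobots (part : Fin NA → Fin NA) (i j : Fin NA) : Fin NA → Fin NA :=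
  fun l => if part l = part j then part i else part l

/-- A conflict `⟨i, j, [ts, te]⟩`. -/
structure Conflict (NA : ℕ) where
  i : Fin NA
  j : Fin NA
  ts : ℕ
  te : ℕ

/-- `K` is a conflict of the joint plan between two different (meta-)robots: throughout `[ts, te]`,
robot `i` violates its collision constraint and robot `j` contributes to its risk. -/
def IsConflict {P : Problem w NA} (ρ : CollisionRisk P) (part : Fin NA → Fin NA)
    (π : JointPlan P) (K : Conflict NA) : Prop :=
  part K.i ≠ part K.j ∧ 1 ≤ K.ts ∧ K.ts ≤ K.te ∧ K.te ≤ π.horizon ∧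
  ∀ k ∈ Finset.Icc K.ts K.te, 1 - P.psafe < π.risk ρ K.i k ∧
    0 < ρ.coll K.i K.j ((π K.i).belief k) ((π K.j).belief k)

/-- A node of the constraint tree. Each group has its constraints, its plan (if one was found), the
number of its current low-level search, and the iterations spent in that search. `origin` is the
conflict whose resolution created the node (`none` for the root). -/
structure Node (P : Problem w NA) where
  cstr : Finset (Fin NA) → List (BeliefConstraint P)
  plan : (G : Finset (Fin NA)) → Option (GroupPlan P G)
  search : Finset (Fin NA) → ℕ
  iters : Finset (Fin NA) → ℕ
  origin : Option (Conflict NA)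

/-- Every (meta-)robot has a plan, that is, the plan of the node is not empty. -/
def Node.HasPlan {P : Problem w NA} (c : Node P) (part : Fin NA → Fin NA) : Prop :=
  ∀ i, (c.plan (grp part i)).isSome

/-- The joint plan of a node. -/
def Node.joint {P : Problem w NA} (c : Node P) (part : Fin NA → Fin NA)
    (h : c.HasPlan part) : JointPlan P :=
  fun i => ((c.plan (grp part i)).get (h i)) ⟨i, mem_grp part i⟩

/-- The random samples of a whole run: the `n`-th search for the group `G` draws `ω (G, n)`. -/
abbrev Samples (NA : ℕ) (S : Type*) : Type _ := Finset (Fin NA) × ℕ → S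

/-- `replan(N, c)`: the searches of the groups without a plan go on for `N` iterations. -/
def replan {P : Problem w NA} {ρ : CollisionRisk P} {S : Type*} (A : Planner P ρ S)
    (ω : Samples NA S) (N : ℕ) (c : Node P) : Node P where
  cstr := c.cstr
  plan G := if (c.plan G).isSome then c.plan G
    else A.run ⟨G, c.cstr G⟩ (ω (G, c.search G)) (c.iters G + N)
  search := c.search
  iters G := if (c.plan G).isSome then c.iters G else c.iters G + N
  origin := c.origin

/-- `getInitPlan`: the root, without constraints. -/
def rootNode {P : Problem w NA} {ρ : CollisionRisk P} {S : Type*} (A : Planner P ρ S)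
    (ω : Samples NA S) (N : ℕ) (fresh : ℕ) : Node P :=
  replan A ω N ⟨fun _ => [], fun _ => none, fun _ => fresh, fun _ => 0, none⟩

/-- `createCSTR`: robot `i` has to satisfy the chance constraint with the current belief of `j`. -/
noncomputable def createCSTR {P : Problem w NA} (π : JointPlan P) (i j : Fin NA) (ts te : ℕ) :
    BeliefConstraint P :=
  ⟨i, j, (π j).belief, ts, te⟩

/-- The child of `c` in which `G`, the group of the constrained robot, gets one more constraint and
is replanned by a new search. -/
def childNode {P : Problem w NA} {ρ : CollisionRisk P} {S : Type*} (A : Planner P ρ S)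
    (ω : Samples NA S) (N : ℕ) (c : Node P) (K : Conflict NA) (fresh : ℕ)
    (G : Finset (Fin NA)) (β : BeliefConstraint P) : Node P :=
  replan A ω N
    { cstr := Function.update c.cstr G (β :: c.cstr G)
      plan := Function.update c.plan G none
      search := Function.update c.search G fresh
      iters := Function.update c.iters G 0
      origin := some K }

/-- The state of the search: the (meta-)robots, the queue, the number of conflicts that have arisen
since the last (re)start, and the number of the next low-level search. -/
structure SearchState (P : Problem w NA) where
  part : Fin NA → Fin NA
  queue : List (Node P)
  conflicts : ℕ
  fresh : ℕ

/-- The search is going on, or has returned a plan. -/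
inductive Status (P : Problem w NA) where
  | running (s : SearchState P)
  | returned (π : JointPlan P)

/-- The heuristic choices of the high-level search: which node is on top of the queue, and which of
the conflicts of an invalid plan is reported. -/
structure Heuristics (P : Problem w NA) (ρ : CollisionRisk P) where
  top : SearchState P → ℕ
  top_lt : ∀ s, s.queue ≠ [] → top s < s.queue.length
  pick : SearchState P → JointPlan P → Conflict NA
  pick_mem : ∀ s π, (∃ K, IsConflict ρ s.part π K) → IsConflict ρ s.part π (pick s π)

open Classical in
/-- `validatePlan` with the risk values `ρ`: it reports no conflict exactly if the plan satisfies
the chance constraints evaluated with `ρ`. -/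
noncomputable def validatePlan {P : Problem w NA} {ρ : CollisionRisk P} (h : Heuristics P ρ)
    (s : SearchState P) (π : JointPlan P) : Option (Conflict NA) :=
  if π.Solves ρ then none else some (h.pick s π)

/-- Start (or restart) the search for the given (meta-)robots. -/
def start {P : Problem w NA} {ρ : CollisionRisk P} {S : Type*} (A : Planner P ρ S)
    (ω : Samples NA S) (N : ℕ) (part : Fin NA → Fin NA) (fresh : ℕ) : SearchState P :=
  ⟨part, [rootNode A ω N fresh], 0, fresh + 1⟩

open Classical in
/-- One pass through the main loop. A conflict arises when `validatePlan` reports one, and again each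
time the low-level planner is retried on a child node and still finds no plan under the constraint
made from it. When more than `B` conflicts have arisen, the two (meta-)robots of the last one are
merged and the search restarts. -/
noncomputable def step {P : Problem w NA} {ρ : CollisionRisk P} {S : Type*} (A : Planner P ρ S)
    (h : Heuristics P ρ) (N B : ℕ) (ω : Samples NA S) : Status P → Status P
  | .returned π => .returned π
  | .running s =>
    match s.queue[h.top s]? with
    | none => .running s
    | some c =>
      let rest := s.queue.eraseIdx (h.top s)
      if hc : c.HasPlan s.part then
        let π := c.joint s.part hc
        match validatePlan h s π with
        | none => .returned π
        | some K =>
          if B < s.conflicts + 1 then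
            .running (start A ω N (mergeRobots s.part K.i K.j) s.fresh)
          else
            .running
              { part := s.part
                queue := rest ++
                  [childNode A ω N c K s.fresh (grp s.part K.i) (createCSTR π K.i K.j K.ts K.te),
                   childNode A ω N c K s.fresh (grp s.part K.j) (createCSTR π K.j K.i K.ts K.te)]
                conflicts := s.conflicts + 1
                fresh := s.fresh + 1 }
      else
        let c' := replan A ω N c
        match c'.origin with
        | none => .running { s with queue := rest ++ [c'] }
        | some K =>
          if c'.HasPlan s.part then .running { s with queue := rest ++ [c'] }
          else if B < s.conflicts + 1 then
            .running (start A ω N (mergeRobots s.part K.i K.j) s.fresh)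
          else .running { s with queue := rest ++ [c'], conflicts := s.conflicts + 1 }

/-- CC-K-CBS after `t` passes through its main loop, started with every robot on its own. -/
noncomputable def ccKCBS {P : Problem w NA} {ρ : CollisionRisk P} {S : Type*} (A : Planner P ρ S)
    (h : Heuristics P ρ) (N B : ℕ) (ω : Samples NA S) (t : ℕ) : Status P :=
  (step A h N B ω)^[t] (.running (start A ω N id 0))

end CCKCBS

/-! Completeness does not come from exploring the constraint tree: constrained tasks may be
infeasible, and nothing is assumed about them. It comes from merging. Values of `ρ` between distinct
robots are nonnegative, so a `ρ`-solution restricts to a valid unconstrained plan for every group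
(`JointPlan.Solves.restrict`). Hence almost surely all unconstrained searches succeed, over
countably many groups and search numbers (`ae_forall_exists_run_isSome`). Off that null set the
argument is deterministic. After each (re)start the root obtains its plan. Then every pass returns a
plan, uses up conflict budget, gives a pending node its plan, or merges, so only finitely many
passes precede a return or a merge (`SearchState.Regular.halts`). Merges join different groups, so
there are fewer than `NA` of them (`halts_start`). A rejected plan always has a conflict between
groups, since the low-level planner enforces the constraints inside each group
(`Node.Sound.exists_isConflict`). Soundness: a plan is returned only when `validatePlan` accepts it,
and `ρ` dominates the exact risks on the expected beliefs, whose covariances are positive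
semidefinite. -/

namespace CCKCBS

/-! ### Covariances of the expected beliefs -/

section Kalman

variable {n m : Type*} [Fintype n] [Fintype m]

theorem posDef_innovation {C : Matrix m n ℝ} {M : Matrix n n ℝ} {R : Matrix m m ℝ}
    (hM : M.PosSemidef) (hR : R.PosDef) : (C * M * Cᵀ + R).PosDef := by
  have h := hM.mul_mul_conjTranspose_same C
  rw [Matrix.conjTranspose_eq_transpose_of_trivial] at h
  exact Matrix.PosDef.posSemidef_add h hR

/-- Since `M` is symmetric, this is a congruence `D * I⁻¹ * Dᵀ` with `D = M * Cᵀ` and `I` the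
innovation covariance. -/
theorem posSemidef_kalman_correction [DecidableEq m] {C : Matrix m n ℝ} {M : Matrix n n ℝ} {R : Matrix m m ℝ}
    (hM : M.PosSemidef) (hR : R.PosDef) :
    (M * Cᵀ * (C * M * Cᵀ + R)⁻¹ * C * M).PosSemidef := by
  have h := (posDef_innovation (C := C) hM hR).inv.posSemidef.mul_mul_conjTranspose_same (M * Cᵀ)
  have hT : Mᵀ = M := by
    simpa [Matrix.conjTranspose_eq_transpose_of_trivial] using hM.isHermitian.eq
  rw [Matrix.conjTranspose_eq_transpose_of_trivial, Matrix.transpose_mul, hT,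
    Matrix.transpose_transpose, ← Matrix.mul_assoc] at h
  exact h

/-- The updated covariance is positive semidefinite, by the Joseph form of the Kalman update. -/
theorem posSemidef_kalman_update [DecidableEq n] [DecidableEq m] {C : Matrix m n ℝ}
    {M : Matrix n n ℝ} {R : Matrix m m ℝ} (hM : M.PosSemidef) (hR : R.PosDef) :
    (M - M * Cᵀ * (C * M * Cᵀ + R)⁻¹ * C * M).PosSemidef := by
  set I := C * M * Cᵀ + R with hI
  set L := M * Cᵀ * I⁻¹ with hL
  have hu : IsUnit I.det :=
    (Matrix.isUnit_iff_isUnit_det _).1 (posDef_innovation (C := C) hM hR).isUnit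
  have hLI : L * I = M * Cᵀ := by
    rw [hL, Matrix.mul_assoc, Matrix.nonsing_inv_mul _ hu, Matrix.mul_one]
  have h1 := hM.mul_mul_conjTranspose_same (1 - L * C)
  have h2 := hR.posSemidef.mul_mul_conjTranspose_same L
  rw [Matrix.conjTranspose_eq_transpose_of_trivial] at h1 h2
  -- On expansion the right side exceeds the left by `L * I * Lᵀ - M * Cᵀ * Lᵀ`, which vanishes by
  -- `hLI`.
  have key : M - L * C * M = (1 - L * C) * M * (1 - L * C)ᵀ + L * R * Lᵀ := by
    have h3 : L * (C * M * Cᵀ) * Lᵀ + L * R * Lᵀ = M * Cᵀ * Lᵀ := by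
      rw [← Matrix.add_mul, ← Matrix.mul_add, ← hI, hLI]
    rw [Matrix.transpose_sub, Matrix.transpose_one, Matrix.transpose_mul]
    simp only [Matrix.sub_mul, Matrix.mul_sub, Matrix.one_mul, Matrix.mul_one, Matrix.mul_assoc]
      at h3 ⊢
    rw [eq_sub_of_add_eq' h3]
    abel
  rw [key]
  exact h1.add h2

end Kalman

theorem Robot.posSemidef_covs (r : Robot w) (k : ℕ) :
    (r.covs k).1.PosSemidef ∧ (r.covs k).2.PosSemidef := by
  induction k with
  | zero => exact ⟨r.S0_psd, Matrix.PosSemidef.zero⟩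
  | succ k ih =>
    have hM : (r.A * (r.covs k).1 * r.Aᵀ + r.Q).PosSemidef := by
      have h := ih.1.mul_mul_conjTranspose_same r.A
      rw [Matrix.conjTranspose_eq_transpose_of_trivial] at h
      exact h.add r.Q_psd
    refine ⟨posSemidef_kalman_update hM r.R_pd, ?_⟩
    have h := ih.2.mul_mul_conjTranspose_same (r.A - r.B * r.K)
    rw [Matrix.conjTranspose_eq_transpose_of_trivial] at h
    exact h.add (posSemidef_kalman_correction hM r.R_pd)

theorem Robot.posSemidef_gamma (r : Robot w) (k : ℕ) : (r.gamma k).PosSemidef :=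
  (r.posSemidef_covs k).1.add (r.posSemidef_covs k).2

/-- Needed because `IsOverApprox` bounds the risks only at positive semidefinite covariances. -/
theorem MotionPlan.posSemidef_cov {r : Robot w} {H : Set ℕ} (π : MotionPlan r H) (k : ℕ) :
    (π.belief k).cov.PosSemidef :=
  r.posSemidef_gamma _

theorem Robot.nominal_min (r : Robot w) (T : ℕ) (u : Fin T → E r.p) (k : ℕ) :
    r.nominal T u (min k T) = r.nominal T u k := by
  induction k with
  | zero => simp
  | succ k ih =>
    rcases lt_or_ge k T with hk | hk
    · rw [min_eq_left (Nat.succ_le_of_lt hk)]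
    · rw [min_eq_right (hk.trans k.le_succ), Robot.nominal.eq_2, dif_neg hk.not_gt, ← ih,
        min_eq_right hk]

/-- Beliefs freeze at time `π.T`, so times may be cut off at any later horizon. -/
theorem MotionPlan.belief_min {r : Robot w} {H : Set ℕ} (π : MotionPlan r H) {l : ℕ}
    (hl : π.T ≤ l) (k : ℕ) : π.belief (min k l) = π.belief k := by
  have h : min (min k l) π.T = min k π.T := by rw [min_assoc, min_eq_right hl]
  unfold MotionPlan.belief
  rw [← r.nominal_min _ _ (min k l), ← r.nominal_min _ _ k, h]

/-! ### Risks of groups and of joint plans -/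

variable {P : Problem w NA} {ρ : CollisionRisk P}

theorem CollisionRisk.IsOverApprox.coll_nonneg (hρ : ρ.IsOverApprox) {i j : Fin NA} (hij : i ≠ j)
    (π : MotionPlan (P.robot i) P.lengths) (π' : MotionPlan (P.robot j) P.lengths) (k : ℕ) :
    0 ≤ ρ.coll i j (π.belief k) (π'.belief k) :=
  (measureReal_nonneg).trans
    (hρ.2 i j hij _ _ (π.posSemidef_cov k) (π'.posSemidef_cov k))

theorem JointPlan.Solves.exact (hρ : ρ.IsOverApprox) {π : JointPlan P} (hπ : π.Solves ρ) :
    π.Solves P.exactRisk := by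
  refine ⟨fun i k hk => le_trans ?_ (hπ.1 i k hk), hπ.2⟩
  refine add_le_add (hρ.1 i _ ((π i).posSemidef_cov k)) (Finset.sum_le_sum fun j hj => ?_)
  exact hρ.2 i j (Finset.ne_of_mem_erase hj).symm _ _ ((π i).posSemidef_cov k)
    ((π j).posSemidef_cov k)

/-- The plans that a joint plan prescribes for the robots of a group. -/
def JointPlan.restrict (π : JointPlan P) (G : Finset (Fin NA)) : GroupPlan P G :=
  fun i => π i

theorem JointPlan.horizon_restrict_le (π : JointPlan P) (G : Finset (Fin NA)) :
    (π.restrict G).horizon ≤ π.horizon :=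
  Finset.sup_le fun i _ => Finset.le_sup (f := fun i => (π i).T) (Finset.mem_univ (i : Fin NA))

/-- Used in two ways: dropping the outside sum restricts a solution to a group, and its positivity
exhibits a conflict partner in another group. -/
theorem JointPlan.risk_eq_restrict_add (π : JointPlan P) (G : Finset (Fin NA)) (i : G) (k : ℕ) :
    π.risk ρ i k = (π.restrict G).risk ρ i k +
      ∑ j ∈ Gᶜ, ρ.coll i j ((π i).belief k) ((π j).belief k) := by
  unfold JointPlan.risk GroupPlan.risk
  rw [add_assoc]
  congr 1
  have h1 : ∑ j ∈ Finset.univ.erase i, ρ.coll i j ((π.restrict G i).belief k)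
        ((π.restrict G j).belief k) =
      ∑ j ∈ G.erase (i : Fin NA), ρ.coll i j ((π i).belief k) ((π j).belief k) := by
    refine Finset.sum_bij (fun j _ => (j : Fin NA)) ?_ ?_ ?_ ?_
    · intro j hj
      exact Finset.mem_erase.2 ⟨fun h => Finset.ne_of_mem_erase hj (Subtype.ext h), j.2⟩
    · exact fun j _ l _ h => Subtype.ext h
    · intro j hj
      refine ⟨⟨j, Finset.mem_of_mem_erase hj⟩, ?_, rfl⟩
      exact Finset.mem_erase.2 ⟨fun h => Finset.ne_of_mem_erase hj (congrArg Subtype.val h),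
        Finset.mem_univ _⟩
    · exact fun j _ => rfl
  rw [h1, ← Finset.sum_union]
  · congr 1
    ext j
    by_cases hj : j ∈ G
    · simp [hj]
    · have : j ≠ i := fun h => hj (h ▸ i.2)
      simp [hj, this]
  · exact Finset.disjoint_left.2 fun j hj hj' =>
      Finset.mem_compl.1 hj' (Finset.mem_of_mem_erase hj)

theorem GroupPlan.le_horizon {G : Finset (Fin NA)} (γ : GroupPlan P G) (i : G) :
    (γ i).T ≤ γ.horizon :=
  Finset.le_sup (f := fun i => (γ i).T) (Finset.mem_univ i)

theorem GroupPlan.risk_min_horizon {G : Finset (Fin NA)} (γ : GroupPlan P G) (i : G) (k : ℕ) :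
    γ.risk ρ i (min k γ.horizon) = γ.risk ρ i k := by
  unfold GroupPlan.risk
  simp only [fun j : G => (γ j).belief_min (γ.le_horizon j) k]

/-- A plan that meets the chance constraints up to its horizon meets them forever. -/
theorem GroupPlan.risk_le {q : Query P} {γ : GroupPlan P q.group} (h : q.Sat ρ γ) (i : q.group)
    {k : ℕ} (hk : 1 ≤ k) : γ.risk ρ i k ≤ 1 - P.psafe := by
  rw [← γ.risk_min_horizon]
  -- The cut-off time is still at least 1 because plans have positive length.
  exact h.1 i _ (Finset.mem_Icc.2
    ⟨le_min hk ((γ i).T_pos.trans_le (γ.le_horizon i)), min_le_right _ _⟩)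

theorem Query.Sat.unconstrained {q : Query P} {γ : GroupPlan P q.group} (h : q.Sat ρ γ) :
    Query.Sat ρ ⟨q.group, []⟩ γ :=
  ⟨h.1, h.2.1, by simp⟩

theorem JointPlan.Solves.restrict (hρ : ρ.IsOverApprox) {π : JointPlan P} (hπ : π.Solves ρ)
    (G : Finset (Fin NA)) : Query.Sat ρ ⟨G, []⟩ (π.restrict G) := by
  refine ⟨fun i k hk => ?_, fun i => hπ.2 i, by simp⟩
  obtain ⟨hk1, hk2⟩ := Finset.mem_Icc.1 hk
  refine le_trans ?_ (hπ.1 i k (Finset.mem_Icc.2 ⟨hk1, hk2.trans (π.horizon_restrict_le G)⟩))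
  rw [π.risk_eq_restrict_add G i k, le_add_iff_nonneg_right]
  exact Finset.sum_nonneg fun j hj =>
    hρ.coll_nonneg (fun h : (i : Fin NA) = j => Finset.mem_compl.1 hj (h ▸ i.2)) _ _ k

/-! ### Nodes of the constraint tree -/

/-- Every plan of the node satisfies the chance constraints of its own group. -/
def Node.Sound (ρ : CollisionRisk P) (c : Node P) : Prop :=
  ∀ G γ, c.plan G = some γ → Query.Sat ρ ⟨G, []⟩ γ

theorem grp_eq {part : Fin NA → Fin NA} {i l : Fin NA} (h : l ∈ grp part i) :
    grp part l = grp part i := by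
  have h' : part l = part i := by simpa [grp] using h
  simp [grp, h']

theorem Node.restrict_joint (c : Node P) (part : Fin NA → Fin NA) (hc : c.HasPlan part)
    (i : Fin NA) : (c.joint part hc).restrict (grp part i) = (c.plan (grp part i)).get (hc i) := by
  -- The groups of `l` and `i` agree only propositionally, so the dependent plans are compared for
  -- variable groups.
  have aux : ∀ (G G' : Finset (Fin NA)) (_ : G = G') (hG : (c.plan G).isSome)
      (hG' : (c.plan G').isSome) (l : Fin NA) (hl : l ∈ G) (hl' : l ∈ G'),
      (c.plan G).get hG ⟨l, hl⟩ = (c.plan G').get hG' ⟨l, hl'⟩ := by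
    rintro G _ rfl _ _ _ _ _
    rfl
  funext l
  exact aux _ _ (grp_eq l.2) _ _ _ _ _

theorem Node.Sound.restrict_joint {c : Node P} (hs : c.Sound ρ) {part : Fin NA → Fin NA}
    (hc : c.HasPlan part) (i : Fin NA) :
    Query.Sat ρ ⟨grp part i, []⟩ ((c.joint part hc).restrict (grp part i)) := by
  rw [c.restrict_joint]
  exact hs _ _ (Option.some_get _).symm

/-- A rejected plan has a conflict between two different (meta-)robots. -/
theorem Node.Sound.exists_isConflict {c : Node P} (hs : c.Sound ρ) {part : Fin NA → Fin NA}
    (hc : c.HasPlan part) (hn : ¬ (c.joint part hc).Solves ρ) :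
    ∃ K, IsConflict ρ part (c.joint part hc) K := by
  set π := c.joint part hc with hπ
  by_contra hK
  refine hn ⟨fun i k hk => ?_, fun i => ?_⟩
  · by_contra! hlt
    obtain ⟨hk1, hk2⟩ := Finset.mem_Icc.1 hk
    -- The bound inside the group holds even past the group's own horizon, so the excess at `k`
    -- comes from robots outside. One of them contributes a positive term and gives a conflict on
    -- `[k, k]`.
    have hle := GroupPlan.risk_le (hs.restrict_joint hc i) ⟨i, mem_grp part i⟩ hk1
    have heq := π.risk_eq_restrict_add (ρ := ρ) (grp part i) ⟨i, mem_grp part i⟩ k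
    have hpos : 0 < ∑ j ∈ (grp part i)ᶜ, ρ.coll i j ((π i).belief k) ((π j).belief k) := by
      change π.risk ρ i k = _ at heq
      change (π.restrict (grp part i)).risk ρ _ k ≤ _ at hle
      linarith
    obtain ⟨j, hj, hj0⟩ := Finset.exists_lt_of_sum_lt (f := fun _ => (0 : ℝ))
      (by simpa using hpos)
    refine hK ⟨⟨i, j, k, k⟩, fun h => ?_, hk1, le_rfl, hk2, fun l hl => ?_⟩
    · exact Finset.mem_compl.1 hj (by simpa [grp] using h.symm)
    · obtain rfl : l = k := by simpa using hl
      exact ⟨hlt, hj0⟩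
  · exact (hs.restrict_joint hc i).2.1 ⟨i, mem_grp part i⟩

/-! ### Low-level searches under repeated replanning -/

section Search

variable {S : Type*} (A : Planner P ρ S) (ω : Samples NA S) (N : ℕ)

theorem Node.Sound.replan {c : Node P} (hs : c.Sound ρ) : (replan A ω N c).Sound ρ := by
  intro G γ h
  by_cases hG : (c.plan G).isSome
  · exact hs G γ (by simpa [CCKCBS.replan, hG] using h)
  · have h' : A.run ⟨G, c.cstr G⟩ (ω (G, c.search G)) (c.iters G + N) = some γ := by
      simpa [CCKCBS.replan, hG] using h
    exact (A.run_valid _ _ _ _ h').unconstrained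

theorem rootNode_sound (fresh : ℕ) : (rootNode A ω N fresh).Sound ρ :=
  Node.Sound.replan A ω N fun _ _ h => nomatch h

theorem Node.Sound.childNode {c : Node P} (hs : c.Sound ρ) (K : Conflict NA) (fresh : ℕ)
    (G : Finset (Fin NA)) (β : BeliefConstraint P) :
    (childNode A ω N c K fresh G β).Sound ρ := by
  refine Node.Sound.replan A ω N fun G' γ h => ?_
  by_cases hG : G' = G
  · subst hG
    simp at h
  · exact hs G' γ (by simpa [Function.update_of_ne hG] using h)

/-- Retries continue one search with the same samples, so their iterations add up to a single longer
run. -/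
theorem run_eq_none_of_plan_replan_iterate {c : Node P} {G : Finset (Fin NA)} (m : ℕ)
    (h : ((replan A ω N)^[m + 1] c).plan G = none) :
    c.plan G = none ∧
      A.run ⟨G, c.cstr G⟩ (ω (G, c.search G)) (c.iters G + (m + 1) * N) = none := by
  have base : ∀ {c : Node P}, (replan A ω N c).plan G = none → c.plan G = none ∧
      A.run ⟨G, c.cstr G⟩ (ω (G, c.search G)) (c.iters G + N) = none := by
    intro c h
    by_cases hG : (c.plan G).isSome
    · simp [replan, hG] at h
      simp [h] at hG
    · exact ⟨by simpa using hG, by simpa [replan, hG] using h⟩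
  induction m generalizing c with
  | zero => simpa using base h
  | succ m ih =>
    obtain ⟨h1, h2⟩ := ih h
    have hc := (base h1).1
    have hi : c.iters G + (m + 1 + 1) * N = (replan A ω N c).iters G + (m + 1) * N := by
      simp only [replan, hc, Option.isSome_none, Bool.false_eq_true, if_false]
      ring
    rw [hi]
    exact ⟨hc, h2⟩

/-- If the unconstrained searches of all (meta-)robots find plans, so does the root, after finitely
many retries. -/
theorem exists_hasPlan_replan_iterate_rootNode (hN : 0 < N) (part : Fin NA → Fin NA) (fresh : ℕ)
    (h : ∀ G, ∃ n, (A.run ⟨G, []⟩ (ω (G, fresh)) n).isSome) :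
    ∃ m, ((replan A ω N)^[m] (rootNode A ω N fresh)).HasPlan part := by
  choose n hn using h
  refine ⟨Finset.univ.sup n, fun i => ?_⟩
  by_contra hnone
  rw [Option.not_isSome_iff_eq_none] at hnone
  -- `rootNode` is already one `replan` of a blank node, hence `sup n` retries amount to `sup n + 1`
  -- calls.
  have hrun := (run_eq_none_of_plan_replan_iterate A ω N (Finset.univ.sup n) hnone).2
  obtain ⟨γ, hγ⟩ := Option.isSome_iff_exists.1 (hn (grp part i))
  have hle : n (grp part i) ≤ 0 + (Finset.univ.sup n + 1) * N := by
    have h1 : n (grp part i) ≤ Finset.univ.sup n := Finset.le_sup (Finset.mem_univ _)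
    nlinarith
  have hsome := A.run_mono _ _ _ _ _ hle hγ
  exact absurd (hrun.symm.trans hsome) (by simp)

/-! ### Termination -/

variable (h : Heuristics P ρ) (B : ℕ)

/-- The search returns a plan after finitely many further passes. -/
def Halts (σ : Status P) : Prop :=
  ∃ t π, (step A h N B ω)^[t] σ = Status.returned π

variable {A ω N h B}

theorem Halts.of_step {σ : Status P} (hσ : Halts A ω N h B (step A h N B ω σ)) :
    Halts A ω N h B σ :=
  let ⟨t, π, ht⟩ := hσ
  ⟨t + 1, π, ht⟩

/-- The number of (meta-)robots. -/
def numRobots (part : Fin NA → Fin NA) : ℕ := (Finset.univ.image part).card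

/-- No new label appears, and the label `part j` disappears. -/
theorem numRobots_mergeRobots_lt {part : Fin NA → Fin NA} {i j : Fin NA} (hij : part i ≠ part j) :
    numRobots (mergeRobots part i j) < numRobots part := by
  refine Finset.card_lt_card (Finset.ssubset_iff_subset_ne.2 ⟨?_, fun heq => ?_⟩)
  · intro x hx
    obtain ⟨l, -, rfl⟩ := Finset.mem_image.1 hx
    unfold mergeRobots
    split_ifs <;> exact Finset.mem_image_of_mem _ (Finset.mem_univ _)
  · have hj : part j ∈ Finset.univ.image (mergeRobots part i j) :=
      heq ▸ Finset.mem_image_of_mem _ (Finset.mem_univ _)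
    obtain ⟨l, -, hl⟩ := Finset.mem_image.1 hj
    unfold mergeRobots at hl
    split_ifs at hl with h'
    · exact hij hl
    · exact h' hl

/-- What holds of every search state after the root has got its plan. -/
structure SearchState.Regular (ρ : CollisionRisk P) (s : SearchState P) : Prop where
  queue_ne : s.queue ≠ []
  sound : ∀ c ∈ s.queue, c.Sound ρ
  separated : ∀ c ∈ s.queue, ∀ K, c.origin = some K → s.part K.i ≠ s.part K.j
  hasPlan : ∀ c ∈ s.queue, c.origin = none → c.HasPlan s.part

open Classical in
/-- The number of queued nodes whose plan is empty. -/
noncomputable def SearchState.numPending (s : SearchState P) : ℕ :=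
  s.queue.countP fun c => ¬ c.HasPlan s.part

/-- If every merge leads to a search that returns a plan, so does a regular state. -/
theorem SearchState.Regular.halts {s : SearchState P} (hs : s.Regular ρ)
    (hmerge : ∀ i j fresh, s.part i ≠ s.part j →
      Halts A ω N h B (.running (start A ω N (mergeRobots s.part i j) fresh))) :
    Halts A ω N h B (.running s) := by
  classical
  -- Lexicographic induction: the remaining conflict budget first, then the number of pending nodes.
  obtain ⟨d, hd⟩ : ∃ d, B - s.conflicts + 1 = d := ⟨_, rfl⟩
  induction d using Nat.strong_induction_on generalizing s with
  | _ d ihd =>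
  obtain ⟨e, he⟩ : ∃ e, s.numPending = e := ⟨_, rfl⟩
  induction e using Nat.strong_induction_on generalizing s with
  | _ e ihe =>
  have hlt := h.top_lt s hs.queue_ne
  set c := s.queue[h.top s] with hc
  set rest := s.queue.eraseIdx (h.top s) with hrest
  have hget : s.queue[h.top s]? = some c := List.getElem?_eq_getElem hlt
  have hmem : c ∈ s.queue := List.getElem_mem hlt
  have hsub : ∀ {x}, x ∈ rest → x ∈ s.queue := fun hx => List.mem_of_mem_eraseIdx hx
  apply Halts.of_step
  by_cases hp : c.HasPlan s.part
  · by_cases hsol : (c.joint s.part hp).Solves ρ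
    · exact ⟨0, c.joint s.part hp, by simp [step, hget, hp, validatePlan, hsol]⟩
    · have hK := h.pick_mem s _ ((hs.sound c hmem).exists_isConflict hp hsol)
      set K := h.pick s (c.joint s.part hp) with hKdef
      by_cases hB : B < s.conflicts + 1
      · have hstep : step A h N B ω (.running s) =
            .running (start A ω N (mergeRobots s.part K.i K.j) s.fresh) := by
          simp [step, hget, hp, validatePlan, hsol, hB, hKdef]
        rw [hstep]
        exact hmerge _ _ _ hK.1
      · obtain ⟨c₁, c₂, fresh, h1, h2, o1, o2, hstep⟩ : ∃ c₁ c₂ : Node P, ∃ fresh,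
            c₁.Sound ρ ∧ c₂.Sound ρ ∧ c₁.origin = some K ∧ c₂.origin = some K ∧
            step A h N B ω (.running s) =
              .running ⟨s.part, rest ++ [c₁, c₂], s.conflicts + 1, fresh⟩ := by
          refine ⟨_, _, _, ?_, ?_, ?_, ?_, by
            simp only [step, hget, hp, validatePlan, hsol, hB, dite_true, if_false]; rfl⟩
          · exact (hs.sound c hmem).childNode A ω N _ _ _ _
          · exact (hs.sound c hmem).childNode A ω N _ _ _ _
          · rfl
          · rfl
        rw [hstep]
        -- Both children may be pending, which is harmless because the budget has dropped.
        refine ihd (B - (s.conflicts + 1) + 1) (by omega) ?_ hmerge rfl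
        refine ⟨by simp, fun x hx => ?_, fun x hx => ?_, fun x hx => ?_⟩ <;>
          simp only [List.mem_append, List.mem_cons, List.not_mem_nil, or_false] at hx <;>
          rcases hx with hx | rfl | rfl
        · exact hs.sound x (hsub hx)
        · exact h1
        · exact h2
        · exact hs.separated x (hsub hx)
        · rintro _ hK'
          obtain rfl : K = _ := Option.some_injective _ (o1.symm.trans hK')
          exact hK.1
        · rintro _ hK'
          obtain rfl : K = _ := Option.some_injective _ (o2.symm.trans hK')
          exact hK.1
        · exact hs.hasPlan x (hsub hx)
        · intro hn; simp [o1] at hn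
        · intro hn; simp [o2] at hn
  -- The root has its plan, so a pending node is a child, and a failed retry is charged to the
  -- conflict it came from.
  · obtain ⟨K, hK⟩ : ∃ K, c.origin = some K := by
      by_contra! hno
      exact hp (hs.hasPlan c hmem (Option.eq_none_iff_forall_ne_some.2 hno))
    have hK' : (replan A ω N c).origin = some K := hK
    have hsep := hs.separated c hmem K hK
    have hreg : ∀ k, SearchState.Regular ρ ⟨s.part, rest ++ [replan A ω N c], k, s.fresh⟩ := by
      refine fun k => ⟨by simp, fun x hx => ?_, fun x hx => ?_, fun x hx => ?_⟩ <;>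
        simp only [List.mem_append, List.mem_cons, List.not_mem_nil, or_false] at hx <;>
        rcases hx with hx | rfl
      · exact hs.sound x (hsub hx)
      · exact (hs.sound c hmem).replan A ω N
      · exact hs.separated x (hsub hx)
      · exact hs.separated c hmem
      · exact hs.hasPlan x (hsub hx)
      · intro hn; simp [hK'] at hn
    by_cases hp' : (replan A ω N c).HasPlan s.part
    · have hstep : step A h N B ω (.running s) =
          .running ⟨s.part, rest ++ [replan A ω N c], s.conflicts, s.fresh⟩ := by
        simp only [step, hget, hp, dite_false, hK', hp', if_true]
        rfl
      rw [hstep]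
      refine ihe _ ?_ (hreg _) hmerge hd rfl
      -- Up to order, the pending `c` is exchanged for a node with a plan, so one pending node fewer
      -- remains.
      have hperm : (c :: rest).Perm s.queue := List.getElem_cons_eraseIdx_perm hlt
      rw [← he, SearchState.numPending, SearchState.numPending, ← hperm.countP_eq]
      simp [hp, hp']
    · by_cases hB : B < s.conflicts + 1
      · have hstep : step A h N B ω (.running s) =
            .running (start A ω N (mergeRobots s.part K.i K.j) s.fresh) := by
          simp only [step, hget, hp, dite_false, hK', hp', if_false, hB, if_true]
        rw [hstep]
        exact hmerge _ _ _ hsep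
      · have hstep : step A h N B ω (.running s) =
            .running ⟨s.part, rest ++ [replan A ω N c], s.conflicts + 1, s.fresh⟩ := by
          simp only [step, hget, hp, dite_false, hK', hp', if_false, hB]
          rfl
        rw [hstep]
        exact ihd (B - (s.conflicts + 1) + 1) (by omega) (hreg _) hmerge rfl

/-- A search whose queue consists of the root goes on with the root alone, until the root has a
plan. -/
theorem halts_of_replan_iterate_hasPlan {part : Fin NA → Fin NA} {c : Node P} {k fresh m : ℕ}
    (hc : c.origin = none) (hm : ((replan A ω N)^[m] c).HasPlan part)
    (hroot : ∀ c' : Node P, c'.HasPlan part → (c.Sound ρ → c'.Sound ρ) → c'.origin = none →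
      Halts A ω N h B (.running ⟨part, [c'], k, fresh⟩)) :
    Halts A ω N h B (.running ⟨part, [c], k, fresh⟩) := by
  induction m generalizing c with
  | zero => exact hroot c hm id hc
  | succ m ih =>
    by_cases hp : c.HasPlan part
    · exact hroot c hp id hc
    have htop : h.top ⟨part, [c], k, fresh⟩ = 0 := by
      simpa using h.top_lt ⟨part, [c], k, fresh⟩ (by simp)
    have hc' : (replan A ω N c).origin = none := hc
    -- With origin `none` a failed retry counts no conflict, so no merge interrupts the root's
    -- search.
    have hstep : step A h N B ω (.running ⟨part, [c], k, fresh⟩) =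
        .running ⟨part, [replan A ω N c], k, fresh⟩ := by
      simp [step, htop, hp, hc']
    apply Halts.of_step
    rw [hstep]
    exact ih hc' hm fun c' h1 h2 h3 => hroot c' h1 (fun hs => h2 (hs.replan A ω N)) h3

/-- If all unconstrained searches find plans, then every (re)start leads to a plan. -/
theorem halts_start (hN : 0 < N)
    (hrun : ∀ G fresh, ∃ n, (A.run ⟨G, []⟩ (ω (G, fresh)) n).isSome)
    (part : Fin NA → Fin NA) (fresh : ℕ) :
    Halts A ω N h B (.running (start A ω N part fresh)) := by
  -- No base case is needed: once a single group is left, no pair can satisfy `hij`.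
  obtain ⟨d, hd⟩ : ∃ d, numRobots part = d := ⟨_, rfl⟩
  induction d using Nat.strong_induction_on generalizing part fresh with
  | _ d ih =>
  obtain ⟨m, hm⟩ := exists_hasPlan_replan_iterate_rootNode A ω N hN part fresh
    fun G => hrun G fresh
  refine halts_of_replan_iterate_hasPlan rfl hm fun c hc hcs hco => ?_
  refine SearchState.Regular.halts ⟨by simp, ?_, ?_, ?_⟩ fun i j fresh' hij =>
    ih _ (hd ▸ numRobots_mergeRobots_lt hij) _ _ rfl
  · simpa using hcs (rootNode_sound A ω N fresh)
  · simp [hco]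
  · simpa [hco] using hc

/-! ### Soundness -/

/-- A running state becomes `returned` only in the branch where `validatePlan` gives `none`. -/
theorem solves_of_step_eq_returned {σ : Status P} {π : JointPlan P}
    (hσ : ∀ π', σ = Status.returned π' → π'.Solves ρ)
    (hstep : step A h N B ω σ = Status.returned π) : π.Solves ρ := by
  cases σ with
  | returned π' => exact hσ π hstep
  | running s =>
    simp only [step] at hstep
    split at hstep
    · simp at hstep
    · split at hstep
      · split at hstep
        · rename_i hv
          obtain rfl := Status.returned.inj hstep
          by_contra hn
          simp [validatePlan, hn] at hv
        · split at hstep <;> simp at hstep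
      · split at hstep
        · simp at hstep
        · split at hstep
          · simp at hstep
          · split at hstep <;> simp at hstep

theorem solves_of_ccKCBS_eq_returned {t : ℕ} {π : JointPlan P}
    (ht : ccKCBS A h N B ω t = Status.returned π) : π.Solves ρ := by
  induction t generalizing π with
  | zero => simp [ccKCBS] at ht
  | succ t ih =>
    rw [ccKCBS, Function.iterate_succ_apply'] at ht
    exact solves_of_step_eq_returned (fun _ h' => ih h') ht

end Search

/-- Almost surely, every search without constraints finds a plan. -/
theorem ae_forall_exists_run_isSome {S : Type*} [MeasurableSpace S] {μ : Measure S}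
    [IsProbabilityMeasure μ] {A : Planner P ρ S} (hA : A.ProbComplete μ) (hρ : ρ.IsOverApprox)
    {π : JointPlan P} (hπ : π.Solves ρ) :
    ∀ᵐ ω ∂Measure.infinitePi (fun _ : Finset (Fin NA) × ℕ => μ),
      ∀ G fresh, ∃ n, (A.run ⟨G, []⟩ (ω (G, fresh)) n).isSome := by
  rw [ae_all_iff]
  -- Countably many null sets are discarded; only the marginal law `μ` of each coordinate matters
  -- here.
  refine fun G => ae_all_iff.2 fun fresh => ?_
  exact (measurePreserving_eval_infinitePi (fun _ : Finset (Fin NA) × ℕ => μ)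
    (G, fresh)).quasiMeasurePreserving.ae (hA ⟨G, []⟩ ⟨_, hπ.restrict hρ G⟩)

end CCKCBS

open CCKCBS in
theorem mainTheorem2 {w NA : ℕ} (hw : w = 2 ∨ w = 3) (P : Problem w NA)
    (ρ : CollisionRisk P) (hρ : ρ.IsOverApprox)
    {S : Type*} [MeasurableSpace S] (μ : MeasureTheory.Measure S)
    [MeasureTheory.IsProbabilityMeasure μ]
    (A : Planner P ρ S) (hA : A.ProbComplete μ)
    (h : Heuristics P ρ) (N B : ℕ) (hN : 0 < N) (hB : 0 < B) :
    ((∃ π : JointPlan P, π.Solves ρ) →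
      ∀ᵐ ω ∂MeasureTheory.Measure.infinitePi (fun _ : Finset (Fin NA) × ℕ => μ),
        ∃ t π, ccKCBS A h N B ω t = Status.returned π) ∧
    (∀ ω t π, ccKCBS A h N B ω t = Status.returned π →
      π.Solves ρ ∧ π.Solves P.exactRisk) := by
  refine ⟨fun ⟨π, hπ⟩ => ?_, fun ω t π ht => ?_⟩
  · filter_upwards [ae_forall_exists_run_isSome hA hρ hπ] with ω hω
    exact halts_start hN hω id 0
  · have hπ := solves_of_ccKCBS_eq_returned ht
    exact ⟨hπ, hπ.exact hρ⟩
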